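/- Let $\phi:\mathbb{R}^n\to\mathbb{R}\cup\{+\infty\}$, put $[\phi\le 0]:=\{x:\phi(x)\le 0\}$, and let $\bar x$ be a point of the boundary of $[\phi\le 0]$. Assume that $\phi$ is lower-$\mathcal{C}^1$ around $\bar x$, with the following representation: there are an open neighbourhood $V$ of $\bar x$, a compact set $Y\subset\mathbb{R}^m$ and a function $f$ such that $$\phi(x)=\max_{y\in Y} f(x,y)\qquad\text{for all } x\in V,$$ where $f(\cdot,y)$ is of class $\mathcal{C}^1$ on $V$ for every $y\in Y$, and $f(x,y)$ and $\nabla_x f(x,y)$ are jointly continuous in $(x,y)\in V\times Y$. For $x\in V$ let $Y(x):=\{y\in Y: f(x,y)=\phi(x)\}$, and let $\mathcal{Y}(\bar x)$ be the collection of all $Y'\subset Y(\bar x)$ for which there is a sequence $x_k\to\bar x$ in $V$ with $\phi(x_k)>0$ for all $k$ and $Y(x_k)\to Y'$ in the sense of Painlevé–Kuratowski. A vector $v$ is a regular subgradient of $\phi$ at a point $x$ with $\phi(x)$ finite if $\phi(z)\ge\phi(x)+\langle v,z-x\rangle+o(\|z-x\|)$ as $z\to x$. The subdifferential $\partial\phi(x)$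 consists of the limits of regular subgradients $v_k$ of $\phi$ at points $x_k$ with $x_k\to x$ and $\phi(x_k)\to\phi(x)$. The outer limiting subdifferential is $$\partial^>\phi(\bar x):=\Big\{\lim_{k\to\infty}v_k \;:\; x_k\to\bar x,\ \phi(x_k)\to\phi(\bar x),\ \phi(x_k)>\phi(\bar x),\ v_k\in\partial\phi(x_k)\Big\}.$$ The local error bound modulus $\mathrm{ebm}(\phi,\bar x)$ is the supremum of all $\tau>0$ such that $\tau\, d(x,[\phi\le 0])\le\max\{\phi(x),0\}$ for all $x$ in some neighbourhood of $\bar x$, and it is $0$ if there is no such $\tau$; here $d$ is the Euclidean distance. Then $$\partial^>\phi(\bar x)=\bigcup_{Y'\in\mathcal{Y}(\bar x)}\mathrm{co}\,\{\nabla_x f(\bar x,y): y\in Y'\} \qquad\text{and}\qquad \mathrm{ebm}(\phi,\bar x)=d\big(0,\partial^>\phi(\bar x)\big).$$ -/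

import Mathlib

open Filter Topology
open scoped ENNReal NNReal

noncomputable section

namespace ErrorBound

/-- The Euclidean space `ℝⁿ`. -/
abbrev E (n : ℕ) : Type := EuclideanSpace ℝ (Fin n)

/-- The level set `[φ ≤ 0]`. -/
def levelSet {n : ℕ} (φ : E n → EReal) : Set (E n) := {x | φ x ≤ 0}

/-- `φ` satisfies the local error bound inequality `τ d(x, [φ ≤ 0]) ≤ φ(x)₊`
for all `x` in some neighbourhood of `xbar`. -/
def HasLocalErrorBoundWith {n : ℕ} (φ : E n → EReal) (xbar : E n) (τ : ℝ≥0) : Prop :=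
  ∃ U ∈ 𝓝 xbar, ∀ x ∈ U,
    (((τ : ℝ≥0∞) * Metric.infEDist x (levelSet φ) : ℝ≥0∞) : EReal) ≤ max (φ x) 0

/-- The local error bound modulus: the supremum of all constants `τ > 0` in the local error bound
inequality, and `0` (the supremum of the empty set) if there is no such constant. -/
def ebm {n : ℕ} (φ : E n → EReal) (xbar : E n) : ℝ≥0∞ :=
  ⨆ (τ : ℝ≥0) (_ : 0 < τ ∧ HasLocalErrorBoundWith φ xbar τ), (τ : ℝ≥0∞)

/-- Regular subgradients of `g` at `x` (a point where `g` is finite):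
`g(y) ≥ g(x) + ⟪v, y - x⟫ + o(‖y - x‖)`. -/
def regularSubdiff {n : ℕ} (g : E n → EReal) (x : E n) : Set (E n) :=
  {v | g x ≠ ⊤ ∧ g x ≠ ⊥ ∧ ∀ ε : ℝ, 0 < ε → ∀ᶠ y in 𝓝 x,
    g x + ((inner ℝ v (y - x) - ε * ‖y - x‖ : ℝ) : EReal) ≤ g y}

/-- General (limiting) subgradients of `g` at `x` (a point where `g` is finite). -/
def limitingSubdiff {n : ℕ} (g : E n → EReal) (x : E n) : Set (E n) :=
  {v | g x ≠ ⊤ ∧ g x ≠ ⊥ ∧ ∃ (xs vs : ℕ → E n),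
    Tendsto xs atTop (𝓝 x) ∧ Tendsto (fun k => g (xs k)) atTop (𝓝 (g x)) ∧
    (∀ k, vs k ∈ regularSubdiff g (xs k)) ∧ Tendsto vs atTop (𝓝 v)}

/-- The outer limiting subdifferential `∂^> g(xbar)`. -/
def outerLimitingSubdiff {n : ℕ} (g : E n → EReal) (xbar : E n) : Set (E n) :=
  {v | ∃ (xs vs : ℕ → E n),
    Tendsto xs atTop (𝓝 xbar) ∧ Tendsto (fun k => g (xs k)) atTop (𝓝 (g xbar)) ∧
    (∀ k, g xbar < g (xs k)) ∧ (∀ k, vs k ∈ limitingSubdiff g (xs k)) ∧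
    Tendsto vs atTop (𝓝 v)}

/-- Outer limit of a sequence of sets: cluster points of sequences `a k ∈ A k`. -/
def outerLimit {m : ℕ} (A : ℕ → Set (E m)) : Set (E m) :=
  {u | ∃ a : ℕ → E m, (∀ k, a k ∈ A k) ∧ MapClusterPt u atTop a}

/-- Inner limit of a sequence of sets: limits of sequences `a k ∈ A k`. -/
def innerLimit {m : ℕ} (A : ℕ → Set (E m)) : Set (E m) :=
  {u | ∃ a : ℕ → E m, (∀ k, a k ∈ A k) ∧ Tendsto a atTop (𝓝 u)}

/-- Painlevé–Kuratowski convergence `A k → B`. -/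
def PKTendsto {m : ℕ} (A : ℕ → Set (E m)) (B : Set (E m)) : Prop :=
  outerLimit A = B ∧ innerLimit A = B

/-- The gradient `∇ₓ f(x, y)` in the first variable. -/
def gradX {n m : ℕ} (f : E n → E m → ℝ) (x : E n) (y : E m) : E n :=
  gradient (fun x' => f x' y) x

/-- `φ(x) = max_{y ∈ Y} f(x, y)` on the open set `V` is a lower-`C¹` representation of `φ`:
`Y` is compact, every `f(·, y)` is of class `C¹` on `V`, and `f` and `∇ₓ f` are jointly continuous
on `V × Y`. (The maximum is attained, so `φ` is finite on `V`.) -/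
structure IsLowerC1Representation {n m : ℕ} (φ : E n → EReal) (V : Set (E n)) (Y : Set (E m))
    (f : E n → E m → ℝ) : Prop where
  isOpen : IsOpen V
  isCompact : IsCompact Y
  contDiffOn : ∀ y ∈ Y, ContDiffOn ℝ 1 (fun x => f x y) V
  continuousOn : ContinuousOn (fun p : E n × E m => f p.1 p.2) (V ×ˢ Y)
  continuousOn_grad : ContinuousOn (fun p : E n × E m => gradX f p.1 p.2) (V ×ˢ Y)
  isMax : ∀ x ∈ V, IsGreatest ((fun y => (f x y : EReal)) '' Y) (φ x)

/-- The active index set `Y(x) = {y ∈ Y | f(x, y) = φ(x)}`. -/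
def activeSet {n m : ℕ} (φ : E n → EReal) (Y : Set (E m)) (f : E n → E m → ℝ) (x : E n) :
    Set (E m) :=
  {y | y ∈ Y ∧ (f x y : EReal) = φ x}

/-- The limiting active index sets: the `Y' ⊆ Y(xbar)` for which there is a sequence
`x k → xbar` with `φ(x k) > 0` and `Y(x k) → Y'`; the mapping `Y(·)` has domain `V`. -/
def limitingActiveSets {n m : ℕ} (φ : E n → EReal) (V : Set (E n)) (Y : Set (E m))
    (f : E n → E m → ℝ) (xbar : E n) : Set (Set (E m)) :=
  {Y' | Y' ⊆ activeSet φ Y f xbar ∧ ∃ xs : ℕ → E n,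
    (∀ k, xs k ∈ V ∧ 0 < φ (xs k)) ∧ Tendsto xs atTop (𝓝 xbar) ∧
    PKTendsto (fun k => activeSet φ Y f (xs k)) Y'}

end ErrorBound

end

/-! On `V` the subdifferential of `φ` is the convex hull of the active gradients
(`limitingSubdiff_eq`). Active gradients are regular subgradients because `f(·, y)` minorizes `φ`
and touches it at the point. Conversely, in each direction a subgradient is dominated by some active
gradient (`exists_activeSet_le_inner`), and projection onto the compact hull
(`exists_mem_norm_sub_le_of_forall_inner`) turns this domination into membership.

The formula for the outer limiting subdifferential follows by passing to limits along `x_k → xbar`: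
a subsequence of the active sets converges (`exists_subseq_pkTendsto`), and joint continuity of the
gradients carries the directional estimates to the limit.

For the modulus, first-order expansions uniform in `y` show that a subgradient `v_k` at `x_k` forces
`φ(x_k) ≤ (‖v_k‖ + ε) d(x_k, [φ ≤ 0])`, so an error bound constant cannot exceed the norms of outer
limiting subgradients. Conversely, if the bound with constant `τ` fails at `x`, minimizing `φ₊ + τ
dist(·, x)` over a ball yields a nearby point with `φ > 0` and a subgradient of norm at most `τ`,
which `eventually_lt_norm` excludes. -/

namespace ErrorBound

/-! ### Convex hulls, projection and set convergence -/

/-- In `ℝⁿ` the convex hull of a compact set is compact. -/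
theorem isCompact_convexHull {n : ℕ} {s : Set (E n)} (hs : IsCompact s) :
    IsCompact (convexHull ℝ s) := by
  let F : (k : ℕ) → (Fin k → ℝ) × (Fin k → E n) → E n := fun k p => ∑ i, p.1 i • p.2 i
  have hF : ∀ k, Continuous (F k) := fun k => by fun_prop
  have heq : convexHull ℝ s =
      ⋃ k ∈ Finset.range (n + 2), F k '' (stdSimplex ℝ (Fin k) ×ˢ Set.univ.pi fun _ => s) := by
    ext x
    simp only [Set.mem_iUnion, Finset.mem_range, exists_prop, Set.mem_image, Set.mem_prod,
      Set.mem_univ_pi, Prod.exists]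
    constructor
    · intro hx
      obtain ⟨ι, _, z, w, hz, hind, hw, hw1, hx⟩ := eq_pos_convex_span_of_mem_convexHull hx
      have hcard : Fintype.card ι ≤ n + 1 := by
        refine hind.card_le_finrank_succ.trans (Nat.succ_le_succ ?_)
        exact (Submodule.finrank_le _).trans (by simp)
      let e := (Fintype.equivFin ι).symm
      refine ⟨Fintype.card ι, by omega, w ∘ e, z ∘ e, ⟨⟨fun i => (hw _).le, ?_⟩, fun i =>
        hz ⟨_, rfl⟩⟩, ?_⟩
      · rw [← hw1]
        exact e.sum_comp w
      · rw [← hx]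
        exact e.sum_comp fun i => w i • z i
    · rintro ⟨k, -, w, z, ⟨hw, hz⟩, rfl⟩
      exact mem_convexHull_of_exists_fintype w z hw.1 hw.2 hz rfl
  rw [heq]
  exact (Finset.range (n + 2)).isCompact_biUnion fun k _ =>
    ((isCompact_stdSimplex ℝ (Fin k)).prod (isCompact_univ_pi fun _ => hs)).image (hF k)

/-- A point at which every linear functional is dominated, up to a slack `τ ‖d‖`, by the values
on a compact convex set lies within distance `τ` of that set. -/
theorem exists_mem_norm_sub_le_of_forall_inner {n : ℕ} {C : Set (E n)} (hC : IsCompact C)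
    (hconv : Convex ℝ C) (u : E n) {τ : ℝ} (hτ : 0 ≤ τ)
    (h : ∀ d : E n, ∃ c ∈ C, inner ℝ u d - τ * ‖d‖ ≤ inner ℝ c d) :
    ∃ w ∈ C, ‖u - w‖ ≤ τ := by
  have hne : C.Nonempty := by
    obtain ⟨c, hc, -⟩ := h 0
    exact ⟨c, hc⟩
  obtain ⟨w, hw, hmin⟩ := exists_norm_eq_iInf_of_complete_convex hne hC.isComplete hconv u
  rw [norm_eq_iInf_iff_real_inner_le_zero hconv hw] at hmin
  refine ⟨w, hw, ?_⟩
  -- With `w` the projection of `u`, testing in the direction `u - w` gives `‖u - w‖² ≤ ⟪u - w, u -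
  -- c⟫ ≤ τ ‖u - w‖`.
  obtain ⟨c, hc, hcd⟩ := h (u - w)
  have h1 := hmin c hc
  have h2 : ‖u - w‖ * ‖u - w‖ = inner ℝ (u - w) (u - w) :=
    (real_inner_self_eq_norm_mul_norm _).symm
  have h3 : inner ℝ (u - w) (u - w) = inner ℝ (u - w) (c - w) + inner ℝ (u - w) (u - c) := by
    rw [← inner_add_right]
    congr 1
    abel
  have h4 : inner ℝ (u - w) (u - c) = inner ℝ u (u - w) - inner ℝ c (u - w) := by
    rw [← inner_sub_left, real_inner_comm]
  by_contra! hlt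
  nlinarith [norm_nonneg (u - w)]

/-- Every sequence of nonempty compact subsets of a compact set has a subsequence that converges
in the sense of Painlevé–Kuratowski. -/
theorem exists_subseq_pkTendsto {m : ℕ} {Y : Set (E m)} (hY : IsCompact Y) (A : ℕ → Set (E m))
    (hAc : ∀ k, IsCompact (A k)) (hAn : ∀ k, (A k).Nonempty) (hAY : ∀ k, A k ⊆ Y) :
    ∃ (B : Set (E m)) (σ : ℕ → ℕ), StrictMono σ ∧ IsCompact B ∧
      PKTendsto (fun k => A (σ k)) B := by
  let K : ℕ → TopologicalSpace.NonemptyCompacts (E m) := fun k => ⟨⟨A k, hAc k⟩, hAn k⟩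
  -- The nonempty compact subsets of `Y` form a compact space for the Hausdorff distance, and
  -- Hausdorff convergence implies Painlevé–Kuratowski convergence.
  have hcomp := TopologicalSpace.NonemptyCompacts.isCompact_subsets_of_isCompact hY
  obtain ⟨B, -, σ, hσ, hlim⟩ := hcomp.tendsto_subseq (x := K) (fun k => hAY k)
  refine ⟨B, σ, hσ, B.isCompact, ?_⟩
  have hdist : Tendsto (fun k => Metric.hausdorffDist (A (σ k)) (B : Set (E m))) atTop (𝓝 0) := by
    exact tendsto_iff_dist_tendsto_zero.1 hlim
  have hfin : ∀ k, Metric.hausdorffEDist (A (σ k)) (B : Set (E m)) ≠ ⊤ := fun k =>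
    Metric.hausdorffEDist_ne_top_of_nonempty_of_bounded (hAn _) B.nonempty
      (hAc _).isBounded B.isCompact.isBounded
  have hinner : (B : Set (E m)) ⊆ innerLimit (fun k => A (σ k)) := by
    intro b hb
    choose a ha hab using fun k => (hAc (σ k)).exists_infDist_eq_dist (hAn (σ k)) b
    refine ⟨a, ha, ?_⟩
    rw [tendsto_iff_dist_tendsto_zero]
    refine squeeze_zero (fun _ => dist_nonneg) (fun k => ?_) hdist
    rw [dist_comm, ← hab, Metric.hausdorffDist_comm]
    refine Metric.infDist_le_hausdorffDist_of_mem hb ?_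
    rw [Metric.hausdorffEDist_comm]
    exact hfin k
  have hio : innerLimit (fun k => A (σ k)) ⊆ outerLimit (fun k => A (σ k)) :=
    fun u ⟨a, ha, hau⟩ => ⟨a, ha, hau.mapClusterPt⟩
  have houter : outerLimit (fun k => A (σ k)) ⊆ (B : Set (E m)) := by
    rintro u ⟨a, ha, hau⟩
    obtain ⟨ρ, hρ, hlim'⟩ := hau.tendsto_subseq
    rw [B.isCompact.isClosed.mem_iff_infDist_zero B.nonempty]
    have h1 : Tendsto (fun k => Metric.infDist (a (ρ k)) (B : Set (E m))) atTop (𝓝 0) :=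
      squeeze_zero (fun _ => Metric.infDist_nonneg)
        (fun k => Metric.infDist_le_hausdorffDist_of_mem (ha (ρ k)) (hfin (ρ k)))
        (hdist.comp hρ.tendsto_atTop)
    have h2 : Tendsto (fun k => Metric.infDist (a (ρ k)) (B : Set (E m))) atTop
        (𝓝 (Metric.infDist u (B : Set (E m)))) :=
      ((Metric.continuous_infDist_pt _).tendsto u).comp hlim'
    exact tendsto_nhds_unique h2 h1
  exact ⟨(houter.antisymm (hinner.trans hio)), (hio.trans houter).antisymm hinner⟩

/-- Regular subgradients form a convex set. -/
theorem convex_regularSubdiff {n : ℕ} (g : E n → EReal) (x : E n) :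
    Convex ℝ (regularSubdiff g x) := by
  rintro v ⟨ht, hb, hv⟩ w ⟨-, -, hw⟩ a b ha hb' hab
  refine ⟨ht, hb, fun ε hε => ?_⟩
  filter_upwards [hv ε hε, hw ε hε] with y hvy hwy
  -- At each `y` the combination is dominated by the larger of the two linear terms, so one of the
  -- two given estimates already suffices there.
  have hle : inner ℝ (a • v + b • w) (y - x) ≤ max (inner ℝ v (y - x)) (inner ℝ w (y - x)) := by
    rw [inner_add_left, real_inner_smul_left, real_inner_smul_left]
    exact Convex.combo_le_max _ _ ha hb' hab
  rcases le_max_iff.1 hle with hle | hle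
  · exact (add_le_add le_rfl (EReal.coe_le_coe_iff.2 (sub_le_sub_right hle _))).trans hvy
  · exact (add_le_add le_rfl (EReal.coe_le_coe_iff.2 (sub_le_sub_right hle _))).trans hwy

theorem regularSubdiff_subset_limitingSubdiff {n : ℕ} (g : E n → EReal) (x : E n) :
    regularSubdiff g x ⊆ limitingSubdiff g x := fun v hv =>
  ⟨hv.1, hv.2.1, fun _ => x, fun _ => v, tendsto_const_nhds, tendsto_const_nhds, fun _ => hv,
    tendsto_const_nhds⟩

/-! ### Regularity of lower-`C¹` functions -/

namespace IsLowerC1Representation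

variable {n m : ℕ} {φ : E n → EReal} {V : Set (E n)} {Y : Set (E m)} {f : E n → E m → ℝ}

theorem exists_coe_eq (h : IsLowerC1Representation φ V Y f) {x : E n} (hx : x ∈ V) :
    ∃ y ∈ Y, (f x y : EReal) = φ x :=
  (h.isMax x hx).1

theorem coe_toReal (h : IsLowerC1Representation φ V Y f) {x : E n} (hx : x ∈ V) :
    ((φ x).toReal : EReal) = φ x := by
  obtain ⟨y, -, hy⟩ := h.exists_coe_eq hx
  rw [← hy, EReal.toReal_coe]

theorem mem_activeSet_iff (h : IsLowerC1Representation φ V Y f) {x : E n} (hx : x ∈ V) {y : E m} :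
    y ∈ activeSet φ Y f x ↔ y ∈ Y ∧ f x y = (φ x).toReal := by
  rw [activeSet, Set.mem_ofPred_eq, ← h.coe_toReal hx, EReal.coe_eq_coe_iff, EReal.toReal_coe]

theorem le_toReal (h : IsLowerC1Representation φ V Y f) {x : E n} (hx : x ∈ V) {y : E m}
    (hy : y ∈ Y) : f x y ≤ (φ x).toReal := by
  rw [← EReal.coe_le_coe_iff, h.coe_toReal hx]
  exact (h.isMax x hx).2 ⟨y, hy, rfl⟩

theorem nonempty_activeSet (h : IsLowerC1Representation φ V Y f) {x : E n} (hx : x ∈ V) :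
    (activeSet φ Y f x).Nonempty :=
  h.exists_coe_eq hx

theorem continuousOn_right (h : IsLowerC1Representation φ V Y f) {x : E n} (hx : x ∈ V) :
    ContinuousOn (f x) Y :=
  h.continuousOn.comp (f := fun y => (x, y)) (by fun_prop) fun _ hy => ⟨hx, hy⟩

theorem continuousOn_gradX_right (h : IsLowerC1Representation φ V Y f) {x : E n} (hx : x ∈ V) :
    ContinuousOn (gradX f x) Y :=
  h.continuousOn_grad.comp (f := fun y => (x, y)) (by fun_prop) fun _ hy => ⟨hx, hy⟩

theorem isCompact_activeSet (h : IsLowerC1Representation φ V Y f) {x : E n} (hx : x ∈ V) :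
    IsCompact (activeSet φ Y f x) := by
  have : activeSet φ Y f x = Y ∩ f x ⁻¹' {(φ x).toReal} := by
    ext y
    rw [h.mem_activeSet_iff hx]
    rfl
  rw [this]
  exact h.isCompact.of_isClosed_subset
    ((h.continuousOn_right hx).preimage_isClosed_of_isClosed h.isCompact.isClosed
      isClosed_singleton) Set.inter_subset_left

theorem isCompact_convexHull_gradX (h : IsLowerC1Representation φ V Y f) {x : E n} (hx : x ∈ V)
    {B : Set (E m)} (hB : IsCompact B) (hBY : B ⊆ Y) :
    IsCompact (convexHull ℝ (gradX f x '' B)) :=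
  isCompact_convexHull (hB.image_of_continuousOn ((h.continuousOn_gradX_right hx).mono hBY))

theorem hasGradientAt (h : IsLowerC1Representation φ V Y f) {x : E n} (hx : x ∈ V) {y : E m}
    (hy : y ∈ Y) : HasGradientAt (fun x' => f x' y) (gradX f x y) x :=
  ((((h.contDiffOn y hy).differentiableOn (by norm_num)).differentiableAt
    (h.isOpen.mem_nhds hx))).hasGradientAt

/-- Compactness of `Y` makes joint continuity uniform in `y`. -/
theorem eventually_dist_lt (h : IsLowerC1Representation φ V Y f) {x : E n} (hx : x ∈ V)
    {ε : ℝ} (hε : 0 < ε) : ∀ᶠ x' in 𝓝 x, ∀ y ∈ Y, dist (f x' y) (f x y) < ε := by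
  obtain ⟨v, hv, hvε⟩ := h.isCompact.mem_uniformity_of_prod (f := f) h.continuousOn hx
    (Metric.dist_mem_uniformity hε)
  rw [h.isOpen.nhdsWithin_eq hx] at hv
  filter_upwards [hv] with x' hx' y hy using hvε x' hx' y hy

theorem eventually_dist_gradX_lt (h : IsLowerC1Representation φ V Y f) {x : E n} (hx : x ∈ V)
    {ε : ℝ} (hε : 0 < ε) : ∀ᶠ x' in 𝓝 x, ∀ y ∈ Y, dist (gradX f x' y) (gradX f x y) < ε := by
  obtain ⟨v, hv, hvε⟩ := h.isCompact.mem_uniformity_of_prod (f := gradX f) h.continuousOn_grad hx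
    (Metric.dist_mem_uniformity hε)
  rw [h.isOpen.nhdsWithin_eq hx] at hv
  filter_upwards [hv] with x' hx' y hy using hvε x' hx' y hy

theorem continuousAt_toReal (h : IsLowerC1Representation φ V Y f) {x : E n} (hx : x ∈ V) :
    ContinuousAt (fun x' => (φ x').toReal) x := by
  rw [Metric.continuousAt_iff']
  intro ε hε
  filter_upwards [h.eventually_dist_lt hx hε, h.isOpen.mem_nhds hx] with x' hx' hx'V
  obtain ⟨y, hy⟩ := h.nonempty_activeSet hx
  obtain ⟨y', hy'⟩ := h.nonempty_activeSet hx'V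
  rw [h.mem_activeSet_iff hx] at hy
  rw [h.mem_activeSet_iff hx'V] at hy'
  have h1 := abs_lt.1 (hx' y hy.1)
  have h2 := abs_lt.1 (hx' y' hy'.1)
  have h3 := h.le_toReal hx'V hy.1
  have h4 := h.le_toReal hx hy'.1
  rw [Real.dist_eq, abs_lt]
  constructor <;> linarith [h1.1, h2.2]

theorem continuousAt (h : IsLowerC1Representation φ V Y f) {x : E n} (hx : x ∈ V) :
    ContinuousAt φ x := by
  have h1 : ContinuousAt (fun x' => ((φ x').toReal : EReal)) x :=
    continuous_coe_real_ereal.continuousAt.comp (h.continuousAt_toReal hx)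
  refine h1.congr ?_
  filter_upwards [h.isOpen.mem_nhds hx] with x' hx' using h.coe_toReal hx'

/-- Uniform first-order expansion of the functions `f(·, y)` near a point. -/
theorem exists_ball_abs_sub_le (h : IsLowerC1Representation φ V Y f) {x₀ : E n} (hx₀ : x₀ ∈ V)
    {ε : ℝ} (hε : 0 < ε) : ∃ r > 0, Metric.ball x₀ r ⊆ V ∧
      ∀ x ∈ Metric.ball x₀ r, ∀ z ∈ Metric.ball x₀ r, ∀ y ∈ Y,
        |f z y - f x y - inner ℝ (gradX f x y) (z - x)| ≤ ε * ‖z - x‖ := by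
  obtain ⟨r, hr, hball⟩ := Metric.eventually_nhds_iff_ball.1
    ((h.eventually_dist_gradX_lt hx₀ (half_pos hε)).and (h.isOpen.mem_nhds hx₀))
  have hV : Metric.ball x₀ r ⊆ V := fun x hx => (hball x hx).2
  refine ⟨r, hr, hV, fun x hx z hz y hy => ?_⟩
  have key := (convex_ball x₀ r).norm_image_sub_le_of_norm_hasFDerivWithin_le'
    (f := fun x' => f x' y) (f' := fun x' => innerSL ℝ (gradX f x' y))
    (φ := innerSL ℝ (gradX f x y)) (C := ε)
    (fun x' hx' => (h.hasGradientAt (hV hx') hy).hasFDerivAt.hasFDerivWithinAt) ?_ hx hz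
  · simpa using key
  · intro x' hx'
    rw [← map_sub, innerSL_apply_norm, ← dist_eq_norm]
    have h1 := (hball x' hx').1 y hy
    have h2 := (hball x hx).1 y hy
    have h3 := dist_triangle_right (gradX f x' y) (gradX f x y) (gradX f x₀ y)
    linarith

/-- Limits of active indices are active. -/
theorem mem_activeSet_of_tendsto (h : IsLowerC1Representation φ V Y f) {x : E n} (hx : x ∈ V)
    {xs : ℕ → E n} (hxs : Tendsto xs atTop (𝓝 x)) (hxV : ∀ k, xs k ∈ V) {ys : ℕ → E m}
    (hys : ∀ k, ys k ∈ activeSet φ Y f (xs k)) {y : E m} (hy : Tendsto ys atTop (𝓝 y)) :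
    y ∈ activeSet φ Y f x := by
  have hyY : y ∈ Y := h.isCompact.isClosed.mem_of_tendsto hy (Eventually.of_forall fun k => (hys k).1)
  rw [h.mem_activeSet_iff hx]
  refine ⟨hyY, ?_⟩
  have h1 : Tendsto (fun k => f (xs k) (ys k)) atTop (𝓝 (f x y)) :=
    (h.continuousOn (x, y) ⟨hx, hyY⟩).tendsto.comp
      (tendsto_nhdsWithin_iff.2 ⟨hxs.prodMk_nhds hy, Eventually.of_forall fun k =>
        ⟨hxV k, (hys k).1⟩⟩)
  have h2 : Tendsto (fun k => f (xs k) (ys k)) atTop (𝓝 (φ x).toReal) := by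
    refine ((h.continuousAt_toReal hx).tendsto.comp hxs).congr fun k => ?_
    exact ((h.mem_activeSet_iff (hxV k)).1 (hys k)).2.symm
  exact tendsto_nhds_unique h1 h2

theorem tendsto_gradX (h : IsLowerC1Representation φ V Y f) {x : E n} (hx : x ∈ V)
    {xs : ℕ → E n} (hxs : Tendsto xs atTop (𝓝 x)) (hxV : ∀ k, xs k ∈ V) {ys : ℕ → E m}
    (hys : ∀ k, ys k ∈ Y) {y : E m} (hy : Tendsto ys atTop (𝓝 y)) :
    Tendsto (fun k => gradX f (xs k) (ys k)) atTop (𝓝 (gradX f x y)) :=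
  (h.continuousOn_grad (x, y) ⟨hx, h.isCompact.isClosed.mem_of_tendsto hy
    (Eventually.of_forall hys)⟩).tendsto.comp
    (tendsto_nhdsWithin_iff.2 ⟨hxs.prodMk_nhds hy, Eventually.of_forall fun k =>
      ⟨hxV k, hys k⟩⟩)

/-! ### Subgradients and active gradients -/

/-- A lower bound on the directional growth of `φ` is a lower bound on some active directional
derivative (the nontrivial half of Danskin's formula). -/
theorem exists_activeSet_le_inner (h : IsLowerC1Representation φ V Y f) {x : E n} (hx : x ∈ V)
    (d : E n) (a : ℝ)
    (hd : ∀ ε > 0, ∀ᶠ t in 𝓝[>] (0 : ℝ), (φ x).toReal + t * (a - ε) ≤ (φ (x + t • d)).toReal) :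
    ∃ y ∈ activeSet φ Y f x, a ≤ inner ℝ (gradX f x y) d := by
  have hcont : Tendsto (fun t : ℝ => x + t • d) (𝓝[>] 0) (𝓝 x) := by
    have : Continuous fun t : ℝ => x + t • d := by fun_prop
    simpa using (this.tendsto 0).mono_left nhdsWithin_le_nhds
  -- Here `y` is active at the moved point `x + t • d`, not at `x`; activity at `x` appears only in
  -- the limit. The slack `1 + ‖d‖` adds the error in `hd` to that of the expansion.
  have hstep : ∀ k : ℕ, ∃ t : ℝ, ∃ y ∈ Y, x + t • d ∈ V ∧ dist (x + t • d) x < 1 / ((k : ℝ) + 1) ∧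
      y ∈ activeSet φ Y f (x + t • d) ∧
      a - 1 / ((k : ℝ) + 1) * (1 + ‖d‖) ≤ inner ℝ (gradX f x y) d := by
    intro k
    have hk : (0 : ℝ) < 1 / ((k : ℝ) + 1) := by positivity
    obtain ⟨r, hr, hrV, hexp⟩ := h.exists_ball_abs_sub_le hx hk
    have hev := hcont (Metric.ball_mem_nhds x (lt_min hr hk))
    obtain ⟨t, ⟨htd, htball⟩, ht⟩ := ((hd _ hk).and hev).and self_mem_nhdsWithin |>.exists
    have htball' : dist (x + t • d) x < min r (1 / ((k : ℝ) + 1)) := htball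
    have ht0 : 0 < t := ht
    have hball : x + t • d ∈ Metric.ball x r := htball'.trans_le (min_le_left _ _)
    obtain ⟨y, hy⟩ := h.nonempty_activeSet (hrV hball)
    refine ⟨t, y, hy.1, hrV hball, htball'.trans_le (min_le_right _ _), hy, ?_⟩
    have h1 := (abs_le.1 (hexp x (Metric.mem_ball_self hr) _ hball y hy.1)).2
    rw [add_sub_cancel_left, inner_smul_right, norm_smul, Real.norm_of_nonneg ht0.le] at h1
    have h2 := ((h.mem_activeSet_iff (hrV hball)).1 hy).2
    have h3 := h.le_toReal hx hy.1
    refine le_of_mul_le_mul_left ?_ ht0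
    nlinarith
  choose t y hyY htV htd hy hle using hstep
  obtain ⟨y₀, hy₀, σ, hσ, hlim⟩ := h.isCompact.tendsto_subseq hyY
  have hone : Tendsto (fun k : ℕ => 1 / ((k : ℝ) + 1)) atTop (𝓝 0) :=
    tendsto_one_div_add_atTop_nhds_zero_nat
  have hx' : Tendsto (fun k => x + t k • d) atTop (𝓝 x) := by
    rw [tendsto_iff_dist_tendsto_zero]
    exact squeeze_zero (fun _ => dist_nonneg) (fun k => (htd k).le) hone
  refine ⟨y₀, h.mem_activeSet_of_tendsto hx (hx'.comp hσ.tendsto_atTop) (fun k => htV _)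
    (fun k => hy (σ k)) hlim, ?_⟩
  have h1 : Tendsto (fun k => inner ℝ (gradX f x (y (σ k))) d) atTop
      (𝓝 (inner ℝ (gradX f x y₀) d)) :=
    (h.tendsto_gradX hx (tendsto_const_nhds (x := x)) (fun _ => hx) (fun k => hyY _)
      hlim).inner tendsto_const_nhds
  have h2 : Tendsto (fun k => a - 1 / ((σ k : ℝ) + 1) * (1 + ‖d‖)) atTop (𝓝 a) := by
    simpa using ((hone.comp hσ.tendsto_atTop).mul_const (1 + ‖d‖)).const_sub a
  exact le_of_tendsto_of_tendsto' h2 h1 fun k => hle (σ k)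

/-- Active gradients, and hence their convex combinations, are regular subgradients. -/
theorem convexHull_subset_regularSubdiff (h : IsLowerC1Representation φ V Y f) {x : E n}
    (hx : x ∈ V) :
    convexHull ℝ (gradX f x '' activeSet φ Y f x) ⊆ regularSubdiff φ x := by
  refine convexHull_min ?_ (convex_regularSubdiff φ x)
  rintro _ ⟨y, hy, rfl⟩
  refine ⟨?_, ?_, fun ε hε => ?_⟩
  · rw [← h.coe_toReal hx]; exact EReal.coe_ne_top _
  · rw [← h.coe_toReal hx]; exact EReal.coe_ne_bot _
  · obtain ⟨r, hr, hrV, hexp⟩ := h.exists_ball_abs_sub_le hx hε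
    filter_upwards [Metric.ball_mem_nhds x hr] with z hz
    rw [← h.coe_toReal hx, ← h.coe_toReal (hrV hz), ← EReal.coe_add, EReal.coe_le_coe_iff]
    have h1 := (abs_le.1 (hexp x (Metric.mem_ball_self hr) z hz y hy.1)).1
    have h2 := ((h.mem_activeSet_iff hx).1 hy).2
    have h3 := h.le_toReal (hrV hz) hy.1
    linarith

theorem exists_activeSet_le_inner_of_mem_regularSubdiff (h : IsLowerC1Representation φ V Y f)
    {x : E n} (hx : x ∈ V) {v : E n} (hv : v ∈ regularSubdiff φ x) (d : E n) :
    ∃ y ∈ activeSet φ Y f x, inner ℝ v d ≤ inner ℝ (gradX f x y) d := by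
  refine h.exists_activeSet_le_inner hx d _ fun ε hε => ?_
  have hcont : Tendsto (fun t : ℝ => x + t • d) (𝓝[>] 0) (𝓝 x) := by
    have : Continuous fun t : ℝ => x + t • d := by fun_prop
    simpa using (this.tendsto 0).mono_left nhdsWithin_le_nhds
  -- The `+ 1` covers `d = 0`.
  have hε' : 0 < ε / (‖d‖ + 1) := by positivity
  filter_upwards [hcont.eventually (hv.2.2 _ hε'), hcont.eventually (h.isOpen.mem_nhds hx),
    self_mem_nhdsWithin] with t ht htV ht0
  have ht0' : 0 < t := ht0
  rw [← h.coe_toReal hx, ← h.coe_toReal htV, ← EReal.coe_add, EReal.coe_le_coe_iff,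
    add_sub_cancel_left, inner_smul_right, norm_smul, Real.norm_of_nonneg ht0'.le] at ht
  have h1 : ε / (‖d‖ + 1) * ‖d‖ ≤ ε := by
    rw [div_mul_eq_mul_div, div_le_iff₀ (by positivity)]
    nlinarith [norm_nonneg d]
  nlinarith

/-- The limiting subdifferential of a lower-`C¹` function is the convex hull of the active
gradients. -/
theorem limitingSubdiff_eq (h : IsLowerC1Representation φ V Y f) {x : E n} (hx : x ∈ V) :
    limitingSubdiff φ x = convexHull ℝ (gradX f x '' activeSet φ Y f x) := by
  refine Set.Subset.antisymm ?_ ((h.convexHull_subset_regularSubdiff hx).trans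
    (regularSubdiff_subset_limitingSubdiff φ x))
  rintro v ⟨-, -, xs, vs, hxs, -, hvs, hv⟩
  obtain ⟨N, hN⟩ := eventually_atTop.1 (hxs.eventually (h.isOpen.mem_nhds hx))
  -- Shifting by `N` puts every term of the sequence in `V`.
  have hsh := tendsto_add_atTop_nat N
  have hmem : ∀ d : E n, ∃ c ∈ convexHull ℝ (gradX f x '' activeSet φ Y f x),
      inner ℝ v d - 0 * ‖d‖ ≤ inner ℝ c d := by
    intro d
    choose y hy hle using fun k => h.exists_activeSet_le_inner_of_mem_regularSubdiff
      (hN (k + N) (Nat.le_add_left N k)) (hvs (k + N)) d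
    obtain ⟨y₀, hy₀, σ, hσ, hlim⟩ := h.isCompact.tendsto_subseq fun k => (hy k).1
    have hxσ : Tendsto (fun k => xs (σ k + N)) atTop (𝓝 x) :=
      (hxs.comp hsh).comp hσ.tendsto_atTop
    have hxV : ∀ k, xs (σ k + N) ∈ V := fun k => hN _ (Nat.le_add_left N _)
    refine ⟨gradX f x y₀, subset_convexHull ℝ _ ⟨y₀, h.mem_activeSet_of_tendsto hx hxσ hxV
      (fun k => hy (σ k)) hlim, rfl⟩, ?_⟩
    have h1 : Tendsto (fun k => inner ℝ (gradX f (xs (σ k + N)) (y (σ k))) d) atTop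
        (𝓝 (inner ℝ (gradX f x y₀) d)) :=
      (h.tendsto_gradX hx hxσ hxV (fun k => (hy (σ k)).1) hlim).inner tendsto_const_nhds
    have h2 : Tendsto (fun k => inner ℝ (vs (σ k + N)) d) atTop (𝓝 (inner ℝ v d)) :=
      ((hv.comp hsh).comp hσ.tendsto_atTop).inner tendsto_const_nhds
    simpa using le_of_tendsto_of_tendsto' h2 h1 fun k => hle (σ k)
  obtain ⟨w, hw, hvw⟩ := exists_mem_norm_sub_le_of_forall_inner
    (h.isCompact_convexHull_gradX hx (h.isCompact_activeSet hx) fun _ hy => hy.1)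
    (convex_convexHull ℝ _) v le_rfl hmem
  rwa [sub_eq_zero.1 (norm_le_zero_iff.1 hvw)]

theorem exists_activeSet_le_inner_of_mem_limitingSubdiff (h : IsLowerC1Representation φ V Y f)
    {x : E n} (hx : x ∈ V) {v : E n} (hv : v ∈ limitingSubdiff φ x) (d : E n) :
    ∃ y ∈ activeSet φ Y f x, inner ℝ v d ≤ inner ℝ (gradX f x y) d := by
  rw [h.limitingSubdiff_eq hx] at hv
  exact h.exists_activeSet_le_inner_of_mem_regularSubdiff hx
    (h.convexHull_subset_regularSubdiff hx hv) d

/-! ### The outer limiting subdifferential -/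

theorem eq_zero_of_mem_frontier (h : IsLowerC1Representation φ V Y f) {x : E n} (hx : x ∈ V)
    (hfr : x ∈ frontier (levelSet φ)) : φ x = 0 := by
  have hcont := h.continuousAt hx
  refine le_antisymm ?_ ?_
  · by_contra! hpos
    obtain ⟨z, hz, hzS⟩ := mem_closure_iff_nhds.1 hfr.1 _ (hcont.eventually (lt_mem_nhds hpos))
    exact absurd (show φ z ≤ 0 from hzS) (not_le.2 hz)
  · by_contra! hneg
    refine hfr.2 (mem_interior_iff_mem_nhds.2 ?_)
    filter_upwards [hcont.eventually (gt_mem_nhds hneg)] with z hz using hz.le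

theorem outerLimitingSubdiff_subset (h : IsLowerC1Representation φ V Y f) {x : E n} (hx : x ∈ V)
    (h0 : φ x = 0) :
    outerLimitingSubdiff φ x ⊆
      ⋃ Y' ∈ limitingActiveSets φ V Y f x, convexHull ℝ (gradX f x '' Y') := by
  rintro v ⟨xs, vs, hxs, -, hpos, hvs, hv⟩
  obtain ⟨N, hN⟩ := eventually_atTop.1 (hxs.eventually (h.isOpen.mem_nhds hx))
  have hsh := tendsto_add_atTop_nat N
  have hNV : ∀ k, xs (k + N) ∈ V := fun k => hN _ (Nat.le_add_left N k)
  obtain ⟨B, σ, hσ, hBc, hB⟩ := exists_subseq_pkTendsto h.isCompact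
    (fun k => activeSet φ Y f (xs (k + N))) (fun k => h.isCompact_activeSet (hNV k))
    (fun k => h.nonempty_activeSet (hNV k)) (fun k _ hy => hy.1)
  have hxσ : Tendsto (fun k => xs (σ k + N)) atTop (𝓝 x) := (hxs.comp hsh).comp hσ.tendsto_atTop
  have hvσ : Tendsto (fun k => vs (σ k + N)) atTop (𝓝 v) := (hv.comp hsh).comp hσ.tendsto_atTop
  have hBx : B ⊆ activeSet φ Y f x := by
    intro y hy
    rw [← hB.2] at hy
    obtain ⟨a, ha, hay⟩ := hy
    exact h.mem_activeSet_of_tendsto hx hxσ (fun k => hNV (σ k)) ha hay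
  refine Set.mem_biUnion (x := B) ⟨hBx, fun k => xs (σ k + N), fun k => ⟨hNV _, ?_⟩, hxσ, hB⟩ ?_
  · rw [← h0]
    exact hpos _
  have hmem : ∀ d : E n, ∃ c ∈ convexHull ℝ (gradX f x '' B),
      inner ℝ v d - 0 * ‖d‖ ≤ inner ℝ c d := by
    intro d
    choose y hy hle using fun k => h.exists_activeSet_le_inner_of_mem_limitingSubdiff
      (hNV (σ k)) (hvs (σ k + N)) d
    obtain ⟨y₀, hy₀, ρ, hρ, hlim⟩ := h.isCompact.tendsto_subseq fun k => (hy k).1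
    have hyB : y₀ ∈ B := by
      rw [← hB.1]
      exact ⟨y, hy, hlim.mapClusterPt.of_comp hρ.tendsto_atTop⟩
    refine ⟨gradX f x y₀, subset_convexHull ℝ _ ⟨y₀, hyB, rfl⟩, ?_⟩
    have h1 : Tendsto (fun k => inner ℝ (gradX f (xs (σ (ρ k) + N)) (y (ρ k))) d) atTop
        (𝓝 (inner ℝ (gradX f x y₀) d)) :=
      (h.tendsto_gradX hx (hxσ.comp hρ.tendsto_atTop) (fun k => hNV _)
        (fun k => (hy (ρ k)).1) hlim).inner tendsto_const_nhds
    have h2 : Tendsto (fun k => inner ℝ (vs (σ (ρ k) + N)) d) atTop (𝓝 (inner ℝ v d)) :=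
      (hvσ.comp hρ.tendsto_atTop).inner tendsto_const_nhds
    simpa using le_of_tendsto_of_tendsto' h2 h1 fun k => hle (ρ k)
  obtain ⟨w, hw, hvw⟩ := exists_mem_norm_sub_le_of_forall_inner
    (h.isCompact_convexHull_gradX hx hBc fun _ hy => (hBx hy).1)
    (convex_convexHull ℝ _) v le_rfl hmem
  rwa [sub_eq_zero.1 (norm_le_zero_iff.1 hvw)]

/-- The inner limit of the convex sets `∂φ(x_k)` is convex, so it suffices to reach the generators,
each a limit of gradients at active indices. -/
theorem convexHull_subset_outerLimitingSubdiff (h : IsLowerC1Representation φ V Y f) {x : E n}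
    (hx : x ∈ V) (h0 : φ x = 0) {B : Set (E m)} (hB : B ∈ limitingActiveSets φ V Y f x) :
    convexHull ℝ (gradX f x '' B) ⊆ outerLimitingSubdiff φ x := by
  obtain ⟨-, xs, hxs, hlim, hPK⟩ := hB
  let C : ℕ → Set (E n) := fun k =>
    convexHull ℝ (gradX f (xs k) '' activeSet φ Y f (xs k))
  have hsub : convexHull ℝ (gradX f x '' B) ⊆ innerLimit C := by
    refine convexHull_min ?_ ?_
    · rintro _ ⟨y, hy, rfl⟩
      rw [← hPK.2] at hy
      obtain ⟨a, ha, hay⟩ := hy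
      exact ⟨fun k => gradX f (xs k) (a k), fun k => subset_convexHull ℝ _ ⟨a k, ha k, rfl⟩,
        h.tendsto_gradX hx hlim (fun k => (hxs k).1) (fun k => (ha k).1) hay⟩
    · rintro v ⟨vs, hvs, hv⟩ w ⟨ws, hws, hw⟩ a b ha hb hab
      exact ⟨fun k => a • vs k + b • ws k, fun k =>
        convex_convexHull ℝ _ (hvs k) (hws k) ha hb hab,
        (hv.const_smul a).add (hw.const_smul b)⟩
  intro v hv
  obtain ⟨vs, hvs, hv⟩ := hsub hv
  refine ⟨xs, vs, hlim, (h.continuousAt hx).tendsto.comp hlim, fun k => ?_, fun k => ?_, hv⟩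
  · rw [h0]
    exact (hxs k).2
  · rw [h.limitingSubdiff_eq (hxs k).1]
    exact hvs k

theorem outerLimitingSubdiff_eq (h : IsLowerC1Representation φ V Y f) {x : E n} (hx : x ∈ V)
    (h0 : φ x = 0) :
    outerLimitingSubdiff φ x =
      ⋃ Y' ∈ limitingActiveSets φ V Y f x, convexHull ℝ (gradX f x '' Y') :=
  (h.outerLimitingSubdiff_subset hx h0).antisymm
    (Set.iUnion₂_subset fun _ hB => h.convexHull_subset_outerLimitingSubdiff hx h0 hB)

/-! ### The error bound modulus -/

theorem errorBound_le_iff (h : IsLowerC1Representation φ V Y f) {x : E n} (hx : x ∈ V)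
    (hne : (levelSet φ).Nonempty) (τ : ℝ≥0) :
    (((τ : ℝ≥0∞) * Metric.infEDist x (levelSet φ) : ℝ≥0∞) : EReal) ≤ max (φ x) 0 ↔
      τ * Metric.infDist x (levelSet φ) ≤ max (φ x).toReal 0 := by
  have h1 : (((τ : ℝ≥0∞) * Metric.infEDist x (levelSet φ) : ℝ≥0∞) : EReal) =
      ((τ * Metric.infDist x (levelSet φ) : ℝ) : EReal) := by
    rw [← ENNReal.ofReal_coe_nnreal, ← ENNReal.ofReal_toReal (Metric.infEDist_ne_top hne),
      ← ENNReal.ofReal_mul τ.coe_nonneg, EReal.coe_ennreal_ofReal, Metric.infDist,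
      max_eq_left (mul_nonneg τ.coe_nonneg ENNReal.toReal_nonneg)]
  have h2 : max (φ x) 0 = ((max (φ x).toReal 0 : ℝ) : EReal) := by
    rw [EReal.coe_strictMono.monotone.map_max, h.coe_toReal hx, EReal.coe_zero]
  rw [h1, h2, EReal.coe_le_coe_iff]

theorem toReal_pos_iff (h : IsLowerC1Representation φ V Y f) {x : E n} (hx : x ∈ V) :
    0 < (φ x).toReal ↔ 0 < φ x := by
  conv_rhs => rw [← h.coe_toReal hx]
  exact EReal.coe_pos.symm

theorem toReal_nonpos_iff (h : IsLowerC1Representation φ V Y f) {x : E n} (hx : x ∈ V) :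
    (φ x).toReal ≤ 0 ↔ x ∈ levelSet φ := by
  rw [← not_lt, h.toReal_pos_iff hx, not_lt]
  rfl

/-- A constant in the local error bound inequality bounds the outer limiting subgradients from
below. -/
theorem le_norm_of_mem_outerLimitingSubdiff (h : IsLowerC1Representation φ V Y f) {x₀ : E n}
    (hx₀ : x₀ ∈ V) (h0 : φ x₀ = 0) {τ : ℝ≥0} (hτ : HasLocalErrorBoundWith φ x₀ τ) {v : E n}
    (hv : v ∈ outerLimitingSubdiff φ x₀) : (τ : ℝ) ≤ ‖v‖ := by
  obtain ⟨xs, vs, hxs, -, hpos, hvs, hv⟩ := hv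
  obtain ⟨U, hU, hbound⟩ := hτ
  have hx₀S : x₀ ∈ levelSet φ := h0.le
  refine le_of_forall_pos_le_add fun ε hε => ?_
  obtain ⟨r, hr, hrV, hexp⟩ := h.exists_ball_abs_sub_le hx₀ hε
  refine ge_of_tendsto (hv.norm.add_const ε) ?_
  filter_upwards [hxs.eventually hU, hxs.eventually (Metric.ball_mem_nhds x₀ (half_pos hr))]
    with k hkU hkr
  have hkr' : dist (xs k) x₀ < r / 2 := hkr
  have hkball : xs k ∈ Metric.ball x₀ r := Metric.ball_subset_ball (by linarith) hkr
  have hkV := hrV hkball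
  have hkpos : 0 < (φ (xs k)).toReal := by
    rw [h.toReal_pos_iff hkV, ← h0]
    exact hpos k
  -- The added `ε` absorbs the expansion error and allows division even when `vs k = 0`.
  have hc : 0 < ‖vs k‖ + ε := by positivity
  have hnear : ∀ z ∈ levelSet φ, z ∈ Metric.ball x₀ r →
      (φ (xs k)).toReal ≤ (‖vs k‖ + ε) * dist (xs k) z := by
    intro z hzS hz
    obtain ⟨y, hy, hle⟩ :=
      h.exists_activeSet_le_inner_of_mem_limitingSubdiff hkV (hvs k) (z - xs k)
    have h1 := (abs_le.1 (hexp _ hkball z hz y hy.1)).1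
    have h2 := ((h.mem_activeSet_iff hkV).1 hy).2
    have h3 := h.le_toReal (hrV hz) hy.1
    have h4 := (h.toReal_nonpos_iff (hrV hz)).2 hzS
    have h5 := (abs_le.1 (abs_real_inner_le_norm (vs k) (z - xs k))).1
    rw [dist_comm, dist_eq_norm]
    linarith
  have hfar : ∀ z ∈ levelSet φ, (φ (xs k)).toReal / (‖vs k‖ + ε) ≤ dist (xs k) z := by
    intro z hzS
    rw [div_le_iff₀' hc]
    by_cases hz : z ∈ Metric.ball x₀ r
    · exact hnear z hzS hz
    -- A point outside the ball is farther from `xs k` than `x₀` is, since `dist (xs k) x₀ < r / 2`.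
    · refine (hnear x₀ hx₀S (Metric.mem_ball_self hr)).trans ?_
      have h1 : r ≤ dist z x₀ := not_lt.1 hz
      have h2 := dist_triangle_left z x₀ (xs k)
      exact mul_le_mul_of_nonneg_left (by linarith) hc.le
  have hinf := (Metric.le_infDist ⟨x₀, hx₀S⟩).2 fun {z} hz => hfar z hz
  have hinfpos : 0 < Metric.infDist (xs k) (levelSet φ) := (div_pos hkpos hc).trans_le hinf
  have hb := (h.errorBound_le_iff hkV ⟨x₀, hx₀S⟩ τ).1 (hbound _ hkU)
  rw [max_eq_left hkpos.le] at hb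
  rw [div_le_iff₀' hc] at hinf
  exact le_of_mul_le_mul_right (hb.trans hinf) hinfpos

/-- Near `x₀`, subgradients at points where `φ` is positive are bounded away from zero by any
constant smaller than the distance of `0` to the outer limiting subdifferential. -/
theorem eventually_lt_norm (h : IsLowerC1Representation φ V Y f) {x₀ : E n} (hx₀ : x₀ ∈ V)
    (h0 : φ x₀ = 0) {τ : ℝ≥0} (hτ : (τ : ℝ≥0∞) < Metric.infEDist 0 (outerLimitingSubdiff φ x₀)) :
    ∀ᶠ x in 𝓝 x₀, 0 < φ x → ∀ v ∈ limitingSubdiff φ x, (τ : ℝ) < ‖v‖ := by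
  by_contra hcon
  obtain ⟨xs, hxs, hbad⟩ := exists_seq_forall_of_frequently (not_eventually.1 hcon)
  push Not at hbad
  choose hpos vs hvs hle using hbad
  obtain ⟨v, hvball, σ, hσ, hlim⟩ := (isCompact_closedBall (0 : E n) τ).tendsto_subseq
    (x := vs) fun k => mem_closedBall_zero_iff.2 (hle k)
  have hxσ := hxs.comp hσ.tendsto_atTop
  have hv : v ∈ outerLimitingSubdiff φ x₀ :=
    ⟨xs ∘ σ, vs ∘ σ, hxσ, (h.continuousAt hx₀).tendsto.comp hxσ,
      fun k => by rw [h0]; exact hpos (σ k), fun k => hvs (σ k), hlim⟩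
  have h1 := hτ.trans_le (Metric.infEDist_le_edist_of_mem hv)
  rw [edist_dist, dist_comm, ← ENNReal.ofReal_coe_nnreal] at h1
  exact absurd (Metric.mem_closedBall.1 hvball)
    (not_le.2 ((ENNReal.ofReal_lt_ofReal_iff_of_nonneg τ.coe_nonneg).1 h1))

/-- A point where `φ` is subject to a linear descent bound `τ` has a subgradient of norm at most
`τ`. -/
theorem exists_limitingSubdiff_norm_le (h : IsLowerC1Representation φ V Y f) {z : E n}
    (hz : z ∈ V) {τ : ℝ} (hτ : 0 ≤ τ)
    (hmin : ∀ᶠ x in 𝓝 z, (φ z).toReal - τ * dist x z ≤ (φ x).toReal) :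
    ∃ v ∈ limitingSubdiff φ z, ‖v‖ ≤ τ := by
  have hmem : ∀ d : E n, ∃ c ∈ convexHull ℝ (gradX f z '' activeSet φ Y f z),
      inner ℝ 0 d - τ * ‖d‖ ≤ inner ℝ c d := by
    intro d
    have hcont : Tendsto (fun t : ℝ => z + t • d) (𝓝[>] 0) (𝓝 z) := by
      have : Continuous fun t : ℝ => z + t • d := by fun_prop
      simpa using (this.tendsto 0).mono_left nhdsWithin_le_nhds
    obtain ⟨y, hy, hle⟩ := h.exists_activeSet_le_inner hz d (-(τ * ‖d‖)) fun ε hε => by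
      filter_upwards [hcont.eventually hmin, self_mem_nhdsWithin] with t ht ht0
      have ht0' : 0 < t := ht0
      rw [dist_eq_norm, add_sub_cancel_left, norm_smul, Real.norm_of_nonneg ht0'.le] at ht
      nlinarith
    exact ⟨_, subset_convexHull ℝ _ ⟨y, hy, rfl⟩, by simpa using hle⟩
  obtain ⟨w, hw, hle⟩ := exists_mem_norm_sub_le_of_forall_inner
    (h.isCompact_convexHull_gradX hz (h.isCompact_activeSet hz) fun _ hy => hy.1)
    (convex_convexHull ℝ _) 0 hτ hmem
  rw [← h.limitingSubdiff_eq hz] at hw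
  exact ⟨w, hw, by simpa using hle⟩

theorem hasLocalErrorBoundWith_of_lt (h : IsLowerC1Representation φ V Y f) {x₀ : E n}
    (hx₀ : x₀ ∈ V) (h0 : φ x₀ = 0) {τ : ℝ≥0}
    (hτ : (τ : ℝ≥0∞) < Metric.infEDist 0 (outerLimitingSubdiff φ x₀)) :
    HasLocalErrorBoundWith φ x₀ τ := by
  have hx₀S : x₀ ∈ levelSet φ := h0.le
  obtain ⟨r, hr, hball⟩ := Metric.nhds_basis_closedBall.mem_iff.1
    ((h.eventually_lt_norm hx₀ h0 hτ).and (h.isOpen.mem_nhds hx₀))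
  have hrV : Metric.closedBall x₀ r ⊆ V := fun x hx => (hball hx).2
  refine ⟨Metric.ball x₀ (r / 2), Metric.ball_mem_nhds _ (half_pos hr), fun x hx => ?_⟩
  have hx' : dist x x₀ < r / 2 := hx
  have hxball : x ∈ Metric.closedBall x₀ r := Metric.mem_closedBall.2 (by linarith)
  rw [h.errorBound_le_iff (hrV hxball) ⟨x₀, hx₀S⟩]
  by_contra! hlt
  -- Compactness of the ball gives an exact minimizer of the penalized function, in place of
  -- Ekeland's principle.
  have hcont : ContinuousOn (fun z => max (φ z).toReal 0 + τ * dist z x)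
      (Metric.closedBall x₀ r) := by
    have h1 : ContinuousOn (fun z => (φ z).toReal) (Metric.closedBall x₀ r) := fun z hz =>
      (h.continuousAt_toReal (hrV hz)).continuousWithinAt
    fun_prop
  obtain ⟨z, hz, hzmin⟩ := (isCompact_closedBall x₀ r).exists_isMinOn ⟨x, hxball⟩ hcont
  have hzx : max (φ z).toReal 0 + τ * dist z x ≤ max (φ x).toReal 0 := by
    simpa using hzmin hxball
  -- Otherwise `z` lies in the level set and `τ dist z x ≤ φ₊(x)` contradicts the failure of the
  -- bound at `x`.
  have hzpos : 0 < (φ z).toReal := by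
    by_contra! hneg
    have h1 := Metric.infDist_le_dist_of_mem (x := x) ((h.toReal_nonpos_iff (hrV hz)).1 hneg)
    rw [max_eq_right hneg, zero_add, dist_comm] at hzx
    linarith [mul_le_mul_of_nonneg_left h1 τ.coe_nonneg]
  -- The chain is `τ dist z x ≤ φ₊(x) < τ d(x, [φ ≤ 0]) ≤ τ dist x x₀`. With `dist x x₀ < r / 2` it
  -- keeps `z` inside the open ball, so `z` is a local minimizer without constraint.
  have hdist : dist z x < dist x x₀ := by
    have h1 := Metric.infDist_le_dist_of_mem (x := x) hx₀S
    refine lt_of_mul_lt_mul_left ?_ τ.coe_nonneg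
    linarith [mul_le_mul_of_nonneg_left h1 τ.coe_nonneg, le_max_right (φ z).toReal 0]
  have hzint : z ∈ Metric.ball x₀ r := by
    have := dist_triangle z x x₀
    exact Metric.mem_ball.2 (by linarith)
  obtain ⟨v, hv, hvτ⟩ := h.exists_limitingSubdiff_norm_le (hrV hz) τ.coe_nonneg <| by
    filter_upwards [Metric.isOpen_ball.mem_nhds hzint,
      (h.continuousAt_toReal (hrV hz)).eventually (lt_mem_nhds hzpos)] with x' hx' hx'pos
    have h1 : max (φ z).toReal 0 + τ * dist z x ≤ max (φ x').toReal 0 + τ * dist x' x :=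
      hzmin (Metric.ball_subset_closedBall hx')
    rw [max_eq_left hzpos.le, max_eq_left (le_of_lt hx'pos)] at h1
    linarith [mul_le_mul_of_nonneg_left (dist_triangle x' z x) τ.coe_nonneg]
  exact absurd hvτ (not_le.2 ((hball hz).1 ((h.toReal_pos_iff (hrV hz)).1 hzpos) v hv))

theorem ebm_eq (h : IsLowerC1Representation φ V Y f) {x₀ : E n} (hx₀ : x₀ ∈ V)
    (h0 : φ x₀ = 0) : ebm φ x₀ = Metric.infEDist 0 (outerLimitingSubdiff φ x₀) := by
  refine le_antisymm ?_ ?_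
  · refine iSup₂_le fun τ hτ => Metric.le_infEDist.2 fun v hv => ?_
    rw [edist_dist, dist_zero_left, ← ENNReal.ofReal_coe_nnreal]
    exact ENNReal.ofReal_le_ofReal (h.le_norm_of_mem_outerLimitingSubdiff hx₀ h0 hτ.2 hv)
  · refine ENNReal.le_of_forall_nnreal_lt fun τ hτ => ?_
    -- The supremum runs over positive constants only, so `τ = 0` is treated apart.
    rcases eq_zero_or_pos τ with rfl | hpos
    · simp
    · exact le_iSup₂_of_le τ ⟨hpos, h.hasLocalErrorBoundWith_of_lt hx₀ h0 hτ⟩ le_rfl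

end IsLowerC1Representation

end ErrorBound

theorem mainTheorem2 {n m : ℕ} (φ : ErrorBound.E n → EReal) (hφ : ∀ x, φ x ≠ ⊥)
    (V : Set (ErrorBound.E n)) (Y : Set (ErrorBound.E m))
    (f : ErrorBound.E n → ErrorBound.E m → ℝ) (xbar : ErrorBound.E n) (hxV : xbar ∈ V)
    (hrep : ErrorBound.IsLowerC1Representation φ V Y f)
    (hxbar : xbar ∈ frontier (ErrorBound.levelSet φ)) :
    ErrorBound.outerLimitingSubdiff φ xbar =
        ⋃ Y' ∈ ErrorBound.limitingActiveSets φ V Y f xbar,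
          convexHull ℝ ((fun y => ErrorBound.gradX f xbar y) '' Y') ∧
      ErrorBound.ebm φ xbar =
        Metric.infEDist 0 (ErrorBound.outerLimitingSubdiff φ xbar) := by
  have h0 := hrep.eq_zero_of_mem_frontier hxV hxbar
  exact ⟨hrep.outerLimitingSubdiff_eq hxV h0, hrep.ebm_eq hxV h0⟩
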